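/- Let $G$ be a compact connected Lie group with identity $e$ and normalized (biinvariant) Haar measure $\mu$. Let $N=(N(t))_{t\ge 0}$ be a Poisson process with parameter $\lambda>0$, and let $(X_n)_{n\ge 1}$ be i.i.d. $G$-valued random variables such that the family $(X_n)_{n\ge1}$ is independent of the process $N$. Let $Y$ be the left compound Poisson process $$Y(t)=X_1X_2\cdots X_{N(t)},\qquad t\ge 0,$$ where the product is ordered from left to right and $Y(t)=e$ when $N(t)=0$. Let $U$ be a $G$-valued random variable with law $\mu$. Suppose that there are no proper closed subgroup $S$ of $G$ and no $g\in G$ with $\mathbb P(X_1\in S)=1$ or $\mathbb P(X_1\in gS)=1$. Then $Y(t)$ converges in distribution to $U$ as $t\to\infty$; that is, $\mathbb E(f(Y(t)))\to\int_G f\,d\mu$ for every continuous function $f\colon G\to\mathbb R$. -/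

import Mathlib

open MeasureTheory ProbabilityTheory Filter Topology
open scoped NNReal Pointwise

/-- `N` is a (homogeneous) Poisson process with parameter `rate` on `(Ω, P)`: it starts at `0`,
has independent increments, its increment over `[s, t]` is Poisson distributed with parameter
`rate * (t - s)`, and its paths are almost surely nondecreasing and right-continuous.
(As the paths are nondecreasing, truncated subtraction in `ℕ` is the genuine increment.) -/
structure IsPoissonProcess {Ω : Type*} [MeasurableSpace Ω] (rate : ℝ≥0) (N : ℝ≥0 → Ω → ℕ)
    (P : Measure Ω) : Prop where
  measurable : ∀ t, Measurable (N t)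
  start_zero : ∀ᵐ ω ∂P, N 0 ω = 0
  indep_increments : HasIndepIncrements N P
  law_increment : ∀ s t : ℝ≥0, s ≤ t →
    HasLaw (fun ω => N t ω - N s ω) (poissonMeasure (rate * (t - s))) P
  monotone_path : ∀ᵐ ω ∂P, Monotone (fun t => N t ω)
  rightCts_path : ∀ᵐ ω ∂P, ∀ t, ContinuousWithinAt (fun s => N s ω) (Set.Ici t) t

/-- The left compound Poisson process `Y(t) = X₁ X₂ ⋯ X_{N(t)}`, with the product ordered from left
to right and equal to the identity when `N(t) = 0`.
The sequence is indexed from `0` here: `X n` is the variable usually written `X_{n+1}`. -/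
def leftCompoundPoisson {Ω G : Type*} [Group G] (N : ℝ≥0 → Ω → ℕ) (X : ℕ → Ω → G)
    (t : ℝ≥0) (ω : Ω) : G :=
  ((List.range (N t ω)).map (fun n => X n ω)).prod

/-- The random variable `X` is supported by the set `S`: `P(X ∈ S) = 1`. -/
def IsSupportedBy {Ω G : Type*} [MeasurableSpace Ω] (P : Measure Ω) (X : Ω → G) (S : Set G) :
    Prop :=
  P {ω | X ω ∈ S} = 1

/-! Let `ν` be the law of `X 0`. Conditioning on the number of jumps, the law of `Y(t)` is the
mixture of the convolution powers of `ν` with weights Poisson(`rate * t`). Convolving with `ν`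
shifts the weights by one, which costs only `O(t ^ (-1/2))` in total variation
(`abs_integral_shift_sub_poissonMeasure_le`), so every weak limit `π` satisfies `ν ∗ₘ π = π`.

For such `π` and continuous `f`, the function `h x = ∫ f (x * y) ∂π` is `ν`-harmonic. An `L²`
argument (`ae_mem_rightPeriods_of_harmonic`) puts `ν`-almost every point in the closed subgroup of
right periods of `h`, which is therefore all of `G`. So `h` is constant and `π` is Haar measure;
compactness of the space of probability measures then gives convergence. -/

/-- The subgroup of right periods of a function. -/
def rightPeriods {G : Type*} [Group G] (h : G → ℝ) : Subgroup G where
  carrier := {y | ∀ x, h (x * y) = h x}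
  one_mem' := by simp
  mul_mem' := by
    intro a b ha hb x
    rw [← mul_assoc, hb, ha]
  inv_mem' := by
    intro a ha x
    simpa using (ha (x * a⁻¹)).symm

lemma isClosed_rightPeriods {G : Type*} [Group G] [TopologicalSpace G] [ContinuousMul G]
    {h : G → ℝ} (hh : Continuous h) :
    IsClosed (rightPeriods h : Set G) := by
  have : (rightPeriods h : Set G) = ⋂ x, {y | h (x * y) = h x} := by
    ext y; simp [rightPeriods]
  rw [this]
  exact isClosed_iInter fun x => isClosed_eq (by fun_prop) continuous_const

lemma Continuous.integrable_of_compactSpace {Y : Type*} [TopologicalSpace Y] [CompactSpace Y]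
    [MeasurableSpace Y] [OpensMeasurableSpace Y] {f : Y → ℝ} (hf : Continuous f)
    (ρ : Measure Y) [IsFiniteMeasure ρ] : Integrable f ρ :=
  hf.integrable_of_hasCompactSupport (HasCompactSupport.of_compactSpace f)

/-! ### Invariant measures on compact groups -/

section CompactGroup

variable {G : Type*} [Group G] [TopologicalSpace G] [IsTopologicalGroup G] [CompactSpace G]
  [MeasurableSpace G] [BorelSpace G]

/-- A Haar probability measure on a compact group is right invariant. -/
lemma isMulRightInvariant_of_compactSpace (μ : Measure G) [μ.IsHaarMeasure]
    [IsProbabilityMeasure μ] : μ.IsMulRightInvariant := by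
  refine ⟨fun g => ?_⟩
  have : IsProbabilityMeasure (μ.map (· * g)) :=
    Measure.isProbabilityMeasure_map (measurable_mul_const g).aemeasurable
  exact Measure.isHaarMeasure_eq_of_isProbabilityMeasure _ _

variable [SecondCountableTopology G]

lemma continuous_integral_mul_left {f : G → ℝ} (hf : Continuous f) (ν : Measure G)
    [IsFiniteMeasure ν] : Continuous fun y => ∫ x, f (x * y) ∂ν := by
  simpa using continuous_parametric_integral_of_continuous (μ := ν)
    (f := fun y x => f (x * y)) (by fun_prop) isCompact_univ

lemma continuous_integral_mul_right {f : G → ℝ} (hf : Continuous f) (ν : Measure G)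
    [IsFiniteMeasure ν] : Continuous fun x => ∫ y, f (x * y) ∂ν := by
  simpa using continuous_parametric_integral_of_continuous (μ := ν)
    (f := fun x y => f (x * y)) (by fun_prop) isCompact_univ

/-- With the `ν`-integral innermost, this is the `ρ`-integral of a fixed continuous function, so it
passes to weak limits in `ρ`. -/
lemma integral_mconv_symm {f : G → ℝ} (hf : Continuous f) (ν ρ : Measure G)
    [IsFiniteMeasure ν] [IsFiniteMeasure ρ] :
    ∫ z, f z ∂(ν ∗ₘ ρ) = ∫ y, ∫ x, f (x * y) ∂ν ∂ρ := by
  rw [integral_mconv (hf.integrable_of_compactSpace _)]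
  exact integral_integral_swap
    (Continuous.integrable_of_compactSpace (f := fun p : G × G => f (p.1 * p.2)) (by fun_prop) _)

/-- Choquet–Deny on a compact group: if a continuous `h` satisfies `h x = ∫ h (x * y) ∂ν`, then
`ν`-almost every `y` is a right period of `h`. -/
lemma ae_mem_rightPeriods_of_harmonic (μ : Measure G) [μ.IsHaarMeasure] [IsProbabilityMeasure μ]
    (ν : Measure G) [IsProbabilityMeasure ν] {h : G → ℝ} (hh : Continuous h)
    (harm : ∀ x, ∫ y, h (x * y) ∂ν = h x) : ∀ᵐ y ∂ν, y ∈ rightPeriods h := by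
  have := isMulRightInvariant_of_compactSpace μ
  -- `D y` is the squared `L²(μ)` distance from `h` to its right translate by `y`. Translates have
  -- equal norm, and harmonicity makes the `ν`-mean of the cross term equal to `∫ h ^ 2 ∂μ`, so `D`
  -- has `ν`-mean zero.
  let D : G → ℝ := fun y => ∫ x, (h (x * y) - h x) ^ 2 ∂μ
  have hD0 : ∀ y, 0 ≤ D y := fun y => integral_nonneg fun x => sq_nonneg _
  have hDcont : Continuous D := by
    simpa [D] using continuous_parametric_integral_of_continuous (μ := μ)
      (f := fun y x => (h (x * y) - h x) ^ 2) (by fun_prop) isCompact_univ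
  have hDexp : ∀ y, D y = 2 * ∫ x, h x ^ 2 ∂μ - 2 * ∫ x, h x * h (x * y) ∂μ := by
    intro y
    have e : ∀ x, (h (x * y) - h x) ^ 2 = h (x * y) ^ 2 + h x ^ 2 - 2 * (h x * h (x * y)) := by
      intro x; ring
    simp only [D, e]
    rw [integral_sub, integral_add, integral_const_mul,
      integral_mul_right_eq_self (μ := μ) (fun x => h x ^ 2) y]
    · ring
    all_goals exact Continuous.integrable_of_compactSpace (by fun_prop) _
  have hDint : ∫ y, D y ∂ν = 0 := by
    have hc : Continuous fun y => ∫ x, h x * h (x * y) ∂μ := by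
      simpa using continuous_parametric_integral_of_continuous (μ := μ)
        (f := fun y x => h x * h (x * y)) (by fun_prop) isCompact_univ
    simp only [hDexp]
    have hswap : ∫ y, ∫ x, h x * h (x * y) ∂μ ∂ν = ∫ x, ∫ y, h x * h (x * y) ∂ν ∂μ :=
      integral_integral_swap
        (Continuous.integrable_of_compactSpace (f := fun p : G × G => h p.2 * h (p.2 * p.1))
          (by fun_prop) _)
    rw [integral_sub (integrable_const _) ((hc.integrable_of_compactSpace ν).const_mul 2),
      integral_const_mul (μ := ν) 2 (fun y => ∫ x, h x * h (x * y) ∂μ), hswap]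
    simp [integral_const_mul, harm, pow_two]
  have hae : D =ᵐ[ν] 0 :=
    (integral_eq_zero_iff_of_nonneg hD0 (hDcont.integrable_of_compactSpace ν)).1 hDint
  filter_upwards [hae] with y hy x
  have hcy : Continuous fun x => (h (x * y) - h x) ^ 2 := by fun_prop
  have h1 : (fun x => (h (x * y) - h x) ^ 2) =ᵐ[μ] 0 :=
    (integral_eq_zero_iff_of_nonneg (fun x => sq_nonneg _) (hcy.integrable_of_compactSpace μ)).1 hy
  -- Haar measure charges every nonempty open set, so almost everywhere equality of continuous
  -- functions is equality.
  have h2 := congrFun (hcy.ae_eq_iff_eq μ continuous_zero |>.1 h1) x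
  have h3 : h (x * y) - h x = 0 := by simpa using h2
  linarith

variable [T2Space G]

/-- If no proper closed subgroup carries `ν`, then Haar measure is the only probability measure
that is invariant under left convolution with `ν`. -/
lemma eq_haar_of_mconv_eq (μ : Measure G) [μ.IsHaarMeasure] [IsProbabilityMeasure μ]
    (ν π : Measure G) [IsProbabilityMeasure ν] [IsProbabilityMeasure π]
    (hν : ∀ S : Subgroup G, IsClosed (S : Set G) → (∀ᵐ y ∂ν, y ∈ S) → S = ⊤)
    (hπ : ν ∗ₘ π = π) : π = μ := by
  have := isMulRightInvariant_of_compactSpace μ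
  refine ext_of_forall_integral_eq_of_IsFiniteMeasure fun f => ?_
  have hf : Continuous f := f.continuous
  let h : G → ℝ := fun x => ∫ y, f (x * y) ∂π
  have hh : Continuous h := continuous_integral_mul_right hf π
  have harm : ∀ x, ∫ z, h (x * z) ∂ν = h x := by
    intro x
    have hc : Continuous fun w => f (x * w) := by fun_prop
    have := integral_mconv (μ := ν) (ν := π) (hc.integrable_of_compactSpace _)
    rw [hπ] at this
    simpa [h, mul_assoc] using this.symm
  have htop := hν _ (isClosed_rightPeriods hh) (ae_mem_rightPeriods_of_harmonic μ ν hh harm)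
  have hconst : ∀ x, h x = h 1 := by
    intro x
    have hx : x ∈ rightPeriods h := htop ▸ Subgroup.mem_top x
    simpa using hx 1
  calc ∫ y, f y ∂π = h 1 := by simp [h]
    _ = ∫ x, h x ∂μ := by simp [hconst]
    _ = ∫ y, ∫ x, f (x * y) ∂μ ∂π := integral_integral_swap
        (Continuous.integrable_of_compactSpace (f := fun p : G × G => f (p.1 * p.2))
          (by fun_prop) _)
    _ = ∫ x, f x ∂μ := by simp [integral_mul_right_eq_self (μ := μ) (fun x => f x)]

/-- An asymptotically `ν`-invariant family of probability measures converges weakly to Haar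
measure when no proper closed subgroup carries `ν`. -/
lemma tendsto_haar_of_asymptotically_invariant (μ : Measure G) [μ.IsHaarMeasure]
    [hμ : IsProbabilityMeasure μ] (ν : Measure G) [IsProbabilityMeasure ν]
    (hν : ∀ S : Subgroup G, IsClosed (S : Set G) → (∀ᵐ y ∂ν, y ∈ S) → S = ⊤)
    {ι : Type*} {l : Filter ι} (ρ : ι → ProbabilityMeasure G)
    (hρ : ∀ f : G → ℝ, Continuous f →
      Tendsto (fun t => ∫ z, f z ∂(ν ∗ₘ (ρ t : Measure G)) - ∫ z, f z ∂(ρ t : Measure G)) l (𝓝 0)) :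
    Tendsto ρ l (𝓝 ⟨μ, hμ⟩) := by
  -- By compactness each ultrafilter has a limit law, so only its identification remains.
  rw [tendsto_iff_ultrafilter]
  intro F hF
  obtain ⟨π, -, hπ⟩ := isCompact_univ.ultrafilter_le_nhds (F.map ρ) (by simp)
  have hlim : Tendsto ρ F (𝓝 π) := hπ
  have hint := fun f : G → ℝ => fun hf : Continuous f =>
    (ProbabilityMeasure.tendsto_iff_forall_integral_tendsto.1 hlim)
      (BoundedContinuousFunction.mkOfCompact ⟨f, hf⟩)
  have key : ν ∗ₘ (π : Measure G) = π := by
    refine ext_of_forall_integral_eq_of_IsFiniteMeasure fun f => ?_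
    have hf : Continuous f := f.continuous
    have h1 := hint f hf
    have h2 := hint _ (continuous_integral_mul_left hf ν)
    simp only [BoundedContinuousFunction.mkOfCompact_apply, ContinuousMap.coe_mk] at h1 h2
    simp only [← integral_mconv_symm hf] at h2
    have h3 := (hρ f hf).mono_left hF
    have h4 := tendsto_nhds_unique (h2.sub h1) h3
    linarith
  have hπμ := eq_haar_of_mconv_eq μ ν π hν key
  have : π = ⟨μ, hμ⟩ := Subtype.ext hπμ
  exact this ▸ hlim

end CompactGroup

/-! ### Poisson moments and the shift estimate -/

section Poisson

/-- The Chen–Stein identity for the Poisson distribution. -/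
lemma integral_natCast_mul_poissonMeasure (r : ℝ≥0) {g : ℕ → ℝ}
    (hg : Integrable (fun n => g (n + 1)) (poissonMeasure r)) :
    Integrable (fun n : ℕ => (n : ℝ) * g n) (poissonMeasure r) ∧
      ∫ n : ℕ, (n : ℝ) * g n ∂(poissonMeasure r) = r * ∫ n, g (n + 1) ∂(poissonMeasure r) := by
  have hshift : ∀ (n : ℕ) (c : ℝ), Real.exp (-r) * (r : ℝ) ^ (n + 1) / (n + 1).factorial *
      (((n + 1 : ℕ) : ℝ) * c) = r * (Real.exp (-r) * (r : ℝ) ^ n / n.factorial * c) := by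
    intro n c
    rw [Nat.factorial_succ]
    push_cast
    field_simp
    ring
  have hint : Integrable (fun n : ℕ => (n : ℝ) * g n) (poissonMeasure r) := by
    rw [integrable_poissonMeasure_iff] at hg ⊢
    -- The factor `n` kills the term at `0`, so nothing is lost in reindexing.
    rw [← summable_nat_add_iff 1]
    refine (hg.mul_left (r : ℝ)).congr fun n => ?_
    rw [norm_mul, RCLike.norm_natCast, hshift]
  refine ⟨hint, ?_⟩
  have h1 := (hasSum_integral_poissonMeasure hg).mul_left (r : ℝ)
  have h2 := (hasSum_nat_add_iff' 1).2 (hasSum_integral_poissonMeasure hint)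
  simp only [smul_eq_mul, hshift, Finset.range_one, Finset.sum_singleton, Nat.cast_zero, zero_mul,
    mul_zero, sub_zero] at h1 h2
  exact h2.unique h1

lemma integral_div_sub_one_sq_poissonMeasure {r : ℝ≥0} (hr : 0 < r) :
    Integrable (fun n : ℕ => ((n : ℝ) / r - 1) ^ 2) (poissonMeasure r) ∧
      ∫ n : ℕ, ((n : ℝ) / r - 1) ^ 2 ∂(poissonMeasure r) = 1 / (r : ℝ) := by
  have hr' : (r : ℝ) ≠ 0 := by positivity
  obtain ⟨i1, e1⟩ := integral_natCast_mul_poissonMeasure r (g := fun _ => 1) (integrable_const _)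
  simp only [mul_one, integral_const, probReal_univ, smul_eq_mul] at i1 e1
  obtain ⟨i2, e2⟩ := integral_natCast_mul_poissonMeasure r (g := fun n => (n : ℝ))
    (by simpa using i1.add (integrable_const (1 : ℝ)))
  simp only [Nat.cast_add, Nat.cast_one] at e2
  rw [integral_add i1 (integrable_const _), e1] at e2
  simp only [integral_const, probReal_univ, smul_eq_mul, mul_one] at e2
  have e : (fun n : ℕ => ((n : ℝ) / r - 1) ^ 2) =
      fun n : ℕ => (1 / (r : ℝ) ^ 2) * ((n : ℝ) * n) - (2 / (r : ℝ)) * n + 1 := by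
    ext n; field_simp; ring
  have j2 := i2.const_mul (1 / (r : ℝ) ^ 2)
  have j1 := i1.const_mul (2 / (r : ℝ))
  have j : Integrable (fun n : ℕ => (1 / (r : ℝ) ^ 2) * ((n : ℝ) * n) - (2 / (r : ℝ)) * n)
    (poissonMeasure r) := j2.sub j1
  rw [e]
  refine ⟨j.add (integrable_const _), ?_⟩
  rw [integral_add j (integrable_const _), integral_sub j2 j1, integral_const_mul,
    integral_const_mul, e1, e2]
  simp only [integral_const, probReal_univ, smul_eq_mul, mul_one]
  field_simp
  ring

/-- The total variation distance between a Poisson distribution and its shift by one is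
`O(r ^ (-1/2))`. -/
lemma abs_integral_shift_sub_poissonMeasure_le {r : ℝ≥0} (hr : 0 < r) {a : ℕ → ℝ} {C : ℝ}
    (ha : ∀ n, |a n| ≤ C) :
    |∫ n, a (n + 1) ∂(poissonMeasure r) - ∫ n, a n ∂(poissonMeasure r)| ≤ C / √r := by
  have hr' : (0 : ℝ) < r := by exact_mod_cast hr
  have hs : 0 < √(r : ℝ) := Real.sqrt_pos.2 hr'
  have hC : 0 ≤ C := (abs_nonneg _).trans (ha 0)
  have hia : ∀ b : ℕ → ℝ, (∀ n, |b n| ≤ C) → Integrable b (poissonMeasure r) := fun b hb =>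
    Integrable.of_bound .of_discrete C (ae_of_all _ hb)
  obtain ⟨i1, e1⟩ := integral_natCast_mul_poissonMeasure r (g := a) (hia _ fun n => ha (n + 1))
  obtain ⟨i2, e2⟩ := integral_div_sub_one_sq_poissonMeasure hr
  -- Chen–Stein turns the shift into the density `n / r - 1`, whose variance is `1 / r`.
  have hEq : ∫ n, a (n + 1) ∂(poissonMeasure r) - ∫ n, a n ∂(poissonMeasure r)
      = ∫ n : ℕ, ((n : ℝ) / r - 1) * a n ∂(poissonMeasure r) := by
    have e : (fun n : ℕ => ((n : ℝ) / r - 1) * a n) =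
        fun n : ℕ => (1 / (r : ℝ)) * ((n : ℝ) * a n) - a n := by
      ext n; ring
    rw [e, integral_sub (i1.const_mul _) (hia _ ha), integral_const_mul, e1]
    field_simp
  rw [hEq, ← Real.norm_eq_abs]
  have hdom : Integrable (fun n : ℕ => C / 2 * (1 / √(r : ℝ) + √r * ((n : ℝ) / r - 1) ^ 2))
      (poissonMeasure r) := ((integrable_const _).add (i2.const_mul _)).const_mul _
  refine (norm_integral_le_of_norm_le hdom (ae_of_all _ fun n => ?_)).trans (le_of_eq ?_)
  · set u : ℝ := (n : ℝ) / r - 1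
    -- AM–GM, weighted so that both terms have mean `1 / √r`.
    have h1 : |u| ≤ (1 / √(r : ℝ) + √r * u ^ 2) / 2 := by
      have h2 : 1 / √(r : ℝ) + √r * u ^ 2 - 2 * |u| = (√r * |u| - 1) ^ 2 / √r := by
        rw [← sq_abs u]; field_simp; ring
      have h3 : 0 ≤ (√r * |u| - 1) ^ 2 / √(r : ℝ) := by positivity
      linarith
    rw [Real.norm_eq_abs, abs_mul]
    calc |u| * |a n| ≤ (1 / √(r : ℝ) + √r * u ^ 2) / 2 * C :=
          mul_le_mul h1 (ha n) (abs_nonneg _) ((abs_nonneg _).trans h1)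
      _ = _ := by ring
  · rw [integral_const_mul, integral_add (integrable_const _) (i2.const_mul _),
      integral_const_mul, e2]
    simp only [integral_const, probReal_univ, smul_eq_mul, one_mul]
    have : √(r : ℝ) * (1 / r) = 1 / √r := by
      nth_rewrite 2 [← Real.mul_self_sqrt hr'.le]
      field_simp
    rw [this]
    ring

lemma IsPoissonProcess.hasLaw {Ω : Type*} [MeasurableSpace Ω] {rate : ℝ≥0} {N : ℝ≥0 → Ω → ℕ}
    {P : Measure Ω} (hN : IsPoissonProcess rate N P) (t : ℝ≥0) :
    HasLaw (N t) (poissonMeasure (rate * t)) P := by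
  have h := hN.law_increment 0 t zero_le
  rw [tsub_zero] at h
  refine h.congr ?_
  filter_upwards [hN.start_zero] with ω hω
  simp [hω]

end Poisson

/-! ### Laws of the partial products -/

section RandomWalk

/-- The left-to-right product of the first `n` terms of a sequence. -/
def partialProd {G : Type*} [Group G] (n : ℕ) (x : ℕ → G) : G := ((List.range n).map x).prod

lemma partialProd_succ {G : Type*} [Group G] (n : ℕ) (x : ℕ → G) : partialProd (n + 1) x = partialProd n x * x n := by
  simp [partialProd, List.range_succ]

variable {G : Type*} [Group G] [MeasurableSpace G] [MeasurableMul₂ G]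

lemma measurable_partialProd (n : ℕ) : Measurable (partialProd n : (ℕ → G) → G) := by
  induction n with
  | zero => exact measurable_const
  | succ n ih =>
    simp only [funext (partialProd_succ (G := G) n)]
    exact ih.mul (measurable_pi_apply n)

variable {Ω : Type*} [MeasurableSpace Ω] {P : Measure Ω} {X : ℕ → Ω → G}

lemma indepFun_partialProd (hX : ∀ n, Measurable (X n)) (hXindep : iIndepFun X P) (n : ℕ) :
    IndepFun (fun ω => partialProd n fun k => X k ω) (X n) P := by
  have h := hXindep.indepFun_finset (Finset.range n) {n} (by simp) hX
  -- The padding value `1` is never read: only indices below `n` enter.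
  let φ : ((Finset.range n) → G) → G := fun y =>
    partialProd n fun k => if hk : k ∈ Finset.range n then y ⟨k, hk⟩ else 1
  let ψ : (({n} : Finset ℕ) → G) → G := fun y => y ⟨n, by simp⟩
  have hφ : Measurable φ := by
    refine (measurable_partialProd n).comp (measurable_pi_lambda _ fun k => ?_)
    by_cases hk : k ∈ Finset.range n
    · simpa only [hk, dite_true] using measurable_pi_apply _
    · simp only [hk, dite_false]; exact measurable_const
  have h' := h.comp hφ (show Measurable ψ from measurable_pi_apply _)
  refine h'.congr (ae_of_all _ fun ω => ?_) (ae_of_all _ fun ω => rfl)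
  simp only [φ, Function.comp, partialProd]
  congr 1
  refine List.map_congr_left fun k hk => ?_
  simp [List.mem_range.1 hk]

lemma measurable_leftCompoundPoisson {N : ℝ≥0 → Ω → ℕ} (t : ℝ≥0) (hN : Measurable (N t))
    (hX : ∀ n, Measurable (X n)) : Measurable (leftCompoundPoisson N X t) := by
  have h : Measurable fun p : ℕ × (ℕ → G) => partialProd p.1 p.2 :=
    measurable_from_prod_countable_right measurable_partialProd
  exact h.comp (hN.prodMk (measurable_pi_lambda _ hX))

variable [IsProbabilityMeasure P]

lemma map_partialProd_succ (hX : ∀ n, Measurable (X n)) (hXindep : iIndepFun X P)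
    (hXident : ∀ n, IdentDistrib (X n) (X 0) P P) (n : ℕ) :
    P.map (fun ω => partialProd (n + 1) fun k => X k ω) =
      (P.map fun ω => partialProd n fun k => X k ω) ∗ₘ P.map (X 0) := by
  have hm : Measurable fun ω => partialProd n fun k => X k ω :=
    (measurable_partialProd n).comp (measurable_pi_lambda _ hX)
  rw [← (hXident n).map_eq, ← (indepFun_partialProd hX hXindep n).map_mul_eq_map_mconv_map hm (hX n)]
  simp only [partialProd_succ]
  rfl

/-- The walk grows on the right, but invariance is tested on the left; powers of one measure commute
by associativity. -/
lemma map_partialProd_succ' (hX : ∀ n, Measurable (X n)) (hXindep : iIndepFun X P)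
    (hXident : ∀ n, IdentDistrib (X n) (X 0) P P) (n : ℕ) :
    P.map (fun ω => partialProd (n + 1) fun k => X k ω) =
      P.map (X 0) ∗ₘ (P.map fun ω => partialProd n fun k => X k ω) := by
  have := Measure.isProbabilityMeasure_map (μ := P) (hX 0).aemeasurable
  have hp : ∀ m, IsProbabilityMeasure (P.map fun ω => partialProd m fun k => X k ω) := fun m =>
    Measure.isProbabilityMeasure_map
      ((measurable_partialProd m).comp (measurable_pi_lambda _ hX)).aemeasurable
  induction n with
  | zero =>
    rw [map_partialProd_succ hX hXindep hXident]
    simp [partialProd]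
  | succ n ih =>
    rw [map_partialProd_succ hX hXindep hXident, ih, Measure.mconv_assoc,
      ← map_partialProd_succ hX hXindep hXident, ih]

/-- Conditioning a compound Poisson variable on the number of jumps. -/
lemma integral_leftCompoundPoisson {rate : ℝ≥0} {N : ℝ≥0 → Ω → ℕ}
    (hN : IsPoissonProcess rate N P) (hX : ∀ n, Measurable (X n))
    (hXN : IndepFun (fun ω n => X n ω) (fun ω t => N t ω) P)
    {f : G → ℝ} (hf : Measurable f) {C : ℝ} (hC : ∀ x, |f x| ≤ C) (t : ℝ≥0) :
    ∫ x, f x ∂(P.map (leftCompoundPoisson N X t)) =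
      ∫ n, ∫ x, f x ∂(P.map fun ω => partialProd n fun k => X k ω)
        ∂(poissonMeasure (rate * t)) := by
  have hXm : Measurable fun ω n => X n ω := measurable_pi_lambda _ hX
  have := Measure.isProbabilityMeasure_map (μ := P) hXm.aemeasurable
  have hΦ : Measurable fun p : ℕ × (ℕ → G) => partialProd p.1 p.2 :=
    measurable_from_prod_countable_right measurable_partialProd
  have hind : IndepFun (N t) (fun ω n => X n ω) P :=
    (hXN.comp measurable_id (measurable_pi_apply t)).symm
  have hjoint := (indepFun_iff_map_prod_eq_prod_map_map (hN.measurable t).aemeasurable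
    hXm.aemeasurable).1 hind
  rw [(hN.hasLaw t).map_eq] at hjoint
  have hlaw : P.map (leftCompoundPoisson N X t) =
      ((poissonMeasure (rate * t)).prod (P.map fun ω n => X n ω)).map
        (fun p => partialProd p.1 p.2) := by
    rw [← hjoint, Measure.map_map hΦ ((hN.measurable t).prodMk hXm)]
    rfl
  rw [hlaw, integral_map hΦ.aemeasurable hf.aestronglyMeasurable, integral_prod]
  · refine integral_congr_ae (ae_of_all _ fun n => ?_)
    simp only
    rw [← integral_map (measurable_partialProd n).aemeasurable hf.aestronglyMeasurable,
      Measure.map_map (measurable_partialProd n) hXm]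
    rfl
  · exact Integrable.of_bound (hf.comp hΦ).aestronglyMeasurable C (ae_of_all _ fun p => hC _)

end RandomWalk

/-! ### Convergence of the compound Poisson process -/

/-- The law of a compound Poisson process is asymptotically invariant under left convolution with
the jump law. -/
lemma tendsto_integral_mconv_sub_leftCompoundPoisson {G : Type*} [Group G] [TopologicalSpace G]
    [IsTopologicalGroup G] [CompactSpace G] [SecondCountableTopology G] [MeasurableSpace G]
    [BorelSpace G] {Ω : Type*} [MeasurableSpace Ω] {P : Measure Ω} [IsProbabilityMeasure P]
    {rate : ℝ≥0} (hrate : 0 < rate) {N : ℝ≥0 → Ω → ℕ} (hN : IsPoissonProcess rate N P)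
    {X : ℕ → Ω → G} (hX : ∀ n, Measurable (X n)) (hXindep : iIndepFun X P)
    (hXident : ∀ n, IdentDistrib (X n) (X 0) P P)
    (hXN : IndepFun (fun ω n => X n ω) (fun ω t => N t ω) P) {f : G → ℝ} (hf : Continuous f) :
    Tendsto (fun t => ∫ z, f z ∂(P.map (X 0) ∗ₘ P.map (leftCompoundPoisson N X t)) -
      ∫ z, f z ∂(P.map (leftCompoundPoisson N X t))) atTop (𝓝 0) := by
  obtain ⟨C, hC⟩ : ∃ C, ∀ x, |f x| ≤ C := by
    obtain ⟨C, hC⟩ := (isCompact_range hf.abs).bddAbove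
    exact ⟨C, fun x => hC ⟨x, rfl⟩⟩
  have hν := Measure.isProbabilityMeasure_map (μ := P) (hX 0).aemeasurable
  have hp : ∀ m, IsProbabilityMeasure (P.map fun ω => partialProd m fun k => X k ω) := fun m =>
    Measure.isProbabilityMeasure_map
      ((measurable_partialProd m).comp (measurable_pi_lambda _ hX)).aemeasurable
  have hY : ∀ t, IsProbabilityMeasure (P.map (leftCompoundPoisson N X t)) := fun t =>
    Measure.isProbabilityMeasure_map
      (measurable_leftCompoundPoisson t (hN.measurable t) hX).aemeasurable
  have hle : ∀ (κ : Measure G) [IsProbabilityMeasure κ] (g : G → ℝ), (∀ x, |g x| ≤ C) →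
      |∫ x, g x ∂κ| ≤ C := by
    intro κ _ g hg
    simpa using norm_integral_le_of_norm_le_const (μ := κ) (f := g) (ae_of_all _ hg)
  let a : ℕ → ℝ := fun n => ∫ x, f x ∂(P.map fun ω => partialProd n fun k => X k ω)
  have h0 : ∀ t, ∫ z, f z ∂(P.map (leftCompoundPoisson N X t)) =
      ∫ n, a n ∂(poissonMeasure (rate * t)) := fun t =>
    integral_leftCompoundPoisson hN hX hXN hf.measurable hC t
  have h1 : ∀ t, ∫ z, f z ∂(P.map (X 0) ∗ₘ P.map (leftCompoundPoisson N X t)) =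
      ∫ n, a (n + 1) ∂(poissonMeasure (rate * t)) := by
    intro t
    rw [integral_mconv_symm hf, integral_leftCompoundPoisson hN hX hXN
      (continuous_integral_mul_left hf _).measurable (fun y => hle _ _ fun x => hC _) t]
    refine integral_congr_ae (ae_of_all _ fun n => ?_)
    simp only [a]
    rw [map_partialProd_succ' hX hXindep hXident, integral_mconv_symm hf]
  simp only [h0, h1]
  have hlim : Tendsto (fun t : ℝ≥0 => C / √((rate * t : ℝ≥0) : ℝ)) atTop (𝓝 0) := by
    refine Tendsto.const_div_atTop (Real.tendsto_sqrt_atTop.comp ?_) C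
    exact NNReal.tendsto_coe_atTop.2 (tendsto_id.const_mul_atTop hrate)
  refine squeeze_zero_norm' ?_ hlim
  filter_upwards [eventually_gt_atTop 0] with t ht
  exact abs_integral_shift_sub_poissonMeasure_le (mul_pos hrate ht) fun n => hle _ _ hC

theorem mainTheorem6
    -- a compact connected Lie group `G`
    {E : Type*} [NormedAddCommGroup E] [NormedSpace ℝ E] [FiniteDimensional ℝ E]
    {H : Type*} [TopologicalSpace H] (I : ModelWithCorners ℝ E H)
    {G : Type*} [Group G] [TopologicalSpace G] [T2Space G] [ChartedSpace H G]
    [LieGroup I ((⊤ : ℕ∞) : WithTop ℕ∞) G] [BoundarylessManifold I G] [CompactSpace G] [ConnectedSpace G]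
    [MeasurableSpace G] [BorelSpace G]
    -- its normalized Haar measure
    (μ : Measure G) [μ.IsHaarMeasure] [IsProbabilityMeasure μ]
    -- a Poisson process `N` with parameter `rate > 0`
    {Ω : Type*} [MeasurableSpace Ω] (P : Measure Ω) [IsProbabilityMeasure P]
    (rate : ℝ≥0) (hrate : 0 < rate)
    (N : ℝ≥0 → Ω → ℕ) (hN : IsPoissonProcess rate N P)
    -- i.i.d. `G`-valued variables, jointly independent of `N`
    (X : ℕ → Ω → G) (hX : ∀ n, Measurable (X n))
    (hXindep : iIndepFun X P) (hXident : ∀ n, IdentDistrib (X n) (X 0) P P)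
    (hXN : IndepFun (fun ω n => X n ω) (fun ω t => N t ω) P)
    -- the first variable is supported by no closed proper subgroup and by no coset of one
    (hsupp : ∀ S : Subgroup G, IsClosed (S : Set G) → S ≠ ⊤ →
      ¬ IsSupportedBy P (X 0) (S : Set G) ∧
        ∀ g : G, ¬ IsSupportedBy P (X 0) (g • (S : Set G)))
    -- a uniformly distributed variable `U`
    {Ω' : Type*} [MeasurableSpace Ω'] (P' : Measure Ω') [IsProbabilityMeasure P']
    (U : Ω' → G) (hU : HasLaw U μ P') :
    TendstoInDistribution (fun t : ℝ≥0 => leftCompoundPoisson N X t) atTop U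
      (fun _ => P) P' := by
  have : IsTopologicalGroup G := topologicalGroup_of_lieGroup I ((⊤ : ℕ∞) : WithTop ℕ∞)
  -- Second countability makes the Borel structure on `G × G` the product one, as convolution
  -- requires.
  have : SecondCountableTopology H := I.secondCountableTopology
  have : SecondCountableTopology G := ChartedSpace.secondCountable_of_sigmaCompact H G
  have hν := Measure.isProbabilityMeasure_map (μ := P) (hX 0).aemeasurable
  have hY : ∀ t, AEMeasurable (leftCompoundPoisson N X t) P := fun t =>
    (measurable_leftCompoundPoisson t (hN.measurable t) hX).aemeasurable
  refine ⟨hY, hU.aemeasurable, ?_⟩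
  have hlim := tendsto_haar_of_asymptotically_invariant μ (P.map (X 0)) (fun S hS hae => ?_)
    (fun t => (⟨P.map (leftCompoundPoisson N X t),
      Measure.isProbabilityMeasure_map (hY t)⟩ : ProbabilityMeasure G))
    (fun f hf => tendsto_integral_mconv_sub_leftCompoundPoisson hrate hN hX hXindep hXident hXN hf)
  · have hUμ : (⟨P'.map U, Measure.isProbabilityMeasure_map hU.aemeasurable⟩ :
        ProbabilityMeasure G) = ⟨μ, inferInstance⟩ := Subtype.ext hU.map_eq
    rw [hUμ]
    exact hlim
  · by_contra hne
    refine (hsupp S hS hne).1 ?_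
    exact (mem_ae_iff_prob_eq_one (hX 0 hS.measurableSet)).1
      (ae_of_ae_map (hX 0).aemeasurable hae)
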